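/- Let $\mathscr Q_n$ be a non-singular quadric in $\mathrm{PG}(n,2)$ of projective index $g$ (the largest dimension of a projective subspace contained in $\mathscr Q_n$). Its point-graph $\Gamma$ has the points of $\mathscr Q_n$ as vertices, two distinct points being adjacent when the line joining them is contained in $\mathscr Q_n$. Let $0<s<g$ and let $\alpha_s$ be an $s$-dimensional subspace contained in $\mathscr Q_n$. A point of $\mathscr Q_n$ is of type (i) if it lies in $\alpha_s$; of type (ii) if it does not lie in $\alpha_s$ but lies in some $(s+1)$-dimensional subspace $\Pi$ with $\alpha_s\subset\Pi\subset\mathscr Q_n$; and of type (iii) otherwise. Let $\mathcal X_s$ be the set of points of type (ii) and $\mathcal Y_s$ the set of points of type (i) or (iii). Let $\Gamma_s$ be the graph obtained from $\Gamma$ by the Godsil–McKay construction with the partition $\{\mathcal X_s,\mathcal Y_s\}$: it has the same vertices and edges as $\Gamma$, except that for each vertex $R\in\mathcal Y_s$ with exactly $\frac12|\mathcal X_s|$ neighbours in $\mathcal X_s$, these $\frac12|\mathcal X_s|$ edges are deleted and $R$ is joined to the other vertices of $\mathcal X_s$. Then, as groups of permutations of the points of $\mathscr Q_n$, $$\mathrm{Aut}(\Gamma_s)=(\mathrm{Aut}\,\Gamma)_{\alpha_s},$$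 where $(\mathrm{Aut}\,\Gamma)_{\alpha_s}$ is the subgroup of the automorphisms of $\Gamma$ that fix the set of points of type (i) setwise. Moreover, $\mathrm{Aut}(\Gamma_s)$ has exactly three orbits on the vertices of $\Gamma_s$, namely the sets of vertices of type (i), (ii) and (iii). -/

import Mathlib

open scoped LinearAlgebra.Projectivization Pointwise

/-! ### Graphs: the automorphism group and the Godsil-McKay construction -/

/-- The automorphism group of a graph, as a subgroup of the symmetric group on its vertices, so
that automorphism groups of different graphs on the same vertex set can be compared. -/
def SimpleGraph.autGroup {W : Type*} (G : SimpleGraph W) : Subgroup (Equiv.Perm W) where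
  carrier := {φ | ∀ x y, G.Adj (φ x) (φ y) ↔ G.Adj x y}
  one_mem' := fun _ _ => Iff.rfl
  mul_mem' := fun {φ ψ} hφ hψ x y => (hφ (ψ x) (ψ y)).trans (hψ x y)
  inv_mem' := fun {φ} hφ x y => by
    have h := hφ (φ⁻¹ x) (φ⁻¹ y)
    rw [← Equiv.Perm.mul_apply, ← Equiv.Perm.mul_apply, mul_inv_cancel] at h
    exact h.symm

/-- `y` is a vertex outside `X` with exactly `|X| / 2` neighbours in `X`. -/
def SimpleGraph.IsHalfAdjacent {W : Type*} [Finite W] (G : SimpleGraph W) (X : Set W) (y : W) :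
    Prop :=
  y ∉ X ∧ 2 * (G.neighborSet y ∩ X).ncard = X.ncard

/-- The graph obtained from `G` by the Godsil-McKay construction with the partition `{X, Xᶜ}`:
for each vertex `y` outside `X` with exactly `|X| / 2` neighbours in `X`, the edges from `y` to
these neighbours are deleted and `y` is joined to the other vertices of `X`; all other pairs of
vertices are adjacent exactly when they are adjacent in `G`. -/
def SimpleGraph.godsilMcKay {W : Type*} [Finite W] (G : SimpleGraph W) (X : Set W) :
    SimpleGraph W where
  Adj u v :=
    Xor (G.Adj u v) ((G.IsHalfAdjacent X u ∧ v ∈ X) ∨ (G.IsHalfAdjacent X v ∧ u ∈ X))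
  symm := ⟨fun u v h => by rwa [G.adj_comm v u, or_comm]⟩
  loopless := ⟨fun u h => by
    rcases h with ⟨h, -⟩ | ⟨⟨h, h'⟩ | ⟨h, h'⟩, -⟩
    · exact G.loopless.irrefl u h
    · exact h.1 h'
    · exact h.1 h'⟩

/-! ### Quadrics in projective spaces

The projective space of `V` is `ℙ K V`; its `d`-dimensional subspaces are the linear subspaces of
`V` of dimension `d + 1`. The quadric of a quadratic form `Q` is the set of points at which `Q`
vanishes. -/

namespace Quadric

variable {K V : Type*} [Field K] [AddCommGroup V] [Module K V]

/-- The projective subspace given by `U` is contained in the quadric of `Q`. -/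
def Contains (Q : QuadraticForm K V) (U : Submodule K V) : Prop :=
  ∀ u ∈ U, Q u = 0

/-- The points of the quadric of `Q`. -/
abbrev Point (Q : QuadraticForm K V) : Type _ :=
  {p : ℙ K V // Contains Q p.submodule}

/-- The quadric of `Q` is non-singular: there is no singular point, that is, no nonzero `v` with
`Q v = 0` and `Q (v + w) = Q w` for all `w` (in characteristic two and even projective dimension
the polar form may still have a radical, the nucleus). -/
def IsNonsingular (Q : QuadraticForm K V) : Prop :=
  Q.radical = ⊥

/-- `g` is the projective index of the quadric of `Q`: the largest dimension of a projective
subspace contained in the quadric. -/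
def IsProjectiveIndex (Q : QuadraticForm K V) (g : ℕ) : Prop :=
  IsGreatest {d : ℕ | ∃ U : Submodule K V, Module.finrank K U = d + 1 ∧ Contains Q U} g

/-- The point-graph: distinct points are adjacent when the line joining them is contained in the
quadric. -/
def pointGraph (Q : QuadraticForm K V) : SimpleGraph (Point Q) where
  Adj p r := p ≠ r ∧ Contains Q (p.1.submodule ⊔ r.1.submodule)
  symm := ⟨fun _ _ h => ⟨h.1.symm, by rw [sup_comm]; exact h.2⟩⟩
  loopless := ⟨fun _ h => h.1 rfl⟩

/-- Points of type (i): the points of the quadric in `α`. -/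
def typeOne (Q : QuadraticForm K V) (α : Submodule K V) : Set (Point Q) :=
  {p | p.1.submodule ≤ α}

/-- Points of type (ii): the points of the quadric, not in `α`, that lie in a subspace contained in
the quadric which contains `α` and has dimension one more than `α`. -/
def typeTwo (Q : QuadraticForm K V) (α : Submodule K V) : Set (Point Q) :=
  {p | p ∉ typeOne Q α ∧ ∃ U : Submodule K V,
    Module.finrank K U = Module.finrank K α + 1 ∧ α ≤ U ∧ Contains Q U ∧ p.1.submodule ≤ U}

/-- Points of type (iii): the remaining points of the quadric. -/
def typeThree (Q : QuadraticForm K V) (α : Submodule K V) : Set (Point Q) :=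
  {p | p ∉ typeOne Q α ∧ p ∉ typeTwo Q α}

/-- The graph obtained from the point-graph by the Godsil-McKay construction with the partition of
the points into those of type (ii) and those of type (i) or (iii) with respect to `α`. -/
def switchedGraph [Finite V] (Q : QuadraticForm K V) (α : Submodule K V) :
    SimpleGraph (Point Q) :=
  (pointGraph Q).godsilMcKay (typeTwo Q α)

end Quadric

/-!
Over the field with two elements a point is a nonzero vector, the points of the quadric are the
nonzero singular vectors, and two of them are equal or adjacent exactly when the polar form `B` of
`Q` vanishes on them. A point of the quadric is of type (ii) when it is orthogonal to `α` but not in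
`α`, and of type (iii) when it is not orthogonal to `α`. Translation by an element of `α` not
orthogonal to a point `y` of type (iii) shows that `y` has exactly half of the points of type (ii) as
neighbours, so the construction flips precisely the pairs of types (ii) and (iii): equality or
adjacency in `Γ_s` is the vanishing of `B_s = B + 1_ii ⊗ 1_iii + 1_iii ⊗ 1_ii`
(`binaryForm_switchedGraph`).

An automorphism of `Γ` that fixes `α` preserves the three types, hence `Γ_s`. For the converse it
suffices to recover type (i) from `Γ_s`, since the points of type (ii) are then the common neighbours
of those of type (i), and the switching can be undone. Call a vertex `p` central when every edge `pq`
extends to a triple `p, q, w` whose rows in `B_s` sum to zero. A line of the quadric that meets `α`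
has an even number of points of each of the types (ii) and (iii), so its rows in `B_s` sum to zero
and the points of type (i) are central. A point `p` outside `α` has a neighbour `q` of type (iii)
such that a completing `w` would make the restriction of a linear form to the quadric equal to
`1_ii` or `1_iii`, or would contradict an evaluation at a point of `α`; neither indicator function
is linear, because there are lines with one point of type (ii) and two of type (iii), and lines
consisting of three points of type (iii) (`isCentral_switchedGraph_iff`).

Transitivity on each type is shown with explicit isometries, namely reflections and Siegel
transformations, instead of Witt's extension theorem. For two points `y`, `z` of type (iii) there is
`a ∈ α` with `B(y, a) = B(z, a) = 1`, and the Siegel transformation of `a` and `y + z` stabilises `α`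
and maps `y` to `z`. For orthogonal points `p`, `r` of type (i) or (ii) the Siegel transformation of
`p + r` and a suitable `b` does it, and for non-orthogonal points of type (ii) the reflection in
`p + r`. The vectors `b` that are needed come from `exists_polar_eq_one`, the double orthogonal
theorem for the possibly degenerate form `B`.
-/

namespace Quadric

open QuadraticMap

variable {V : Type*} [AddCommGroup V] [Module (ZMod 2) V] {Q : QuadraticForm (ZMod 2) V}

/-! ### Singular vectors and orthogonality -/

lemma eq_one_of_ne_zero {x : ZMod 2} (h : x ≠ 0) : x = 1 := by
  revert x; decide

lemma eq_of_eq_zero_iff {x y : ZMod 2} (h : x = 0 ↔ y = 0) : x = y := by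
  revert x y; decide

lemma polar_self_eq_zero (v : V) : polar Q v v = 0 := by
  rw [QuadraticMap.polar_self]
  exact (by decide : ∀ x : ZMod 2, 2 • x = 0) _

lemma Contains.polar_eq_zero {W : Submodule (ZMod 2) V} (hW : Contains Q W) {v w : V}
    (hv : v ∈ W) (hw : w ∈ W) : polar Q v w = 0 := by
  simp [polar, hW _ hv, hW _ hw, hW _ (W.add_mem hv hw)]

lemma contains_span_singleton {v : V} (hv : Q v = 0) : Contains Q ((ZMod 2) ∙ v) := by
  intro u hu
  obtain ⟨c, rfl⟩ := Submodule.mem_span_singleton.1 hu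
  simp [QuadraticMap.map_smul, hv]

lemma Contains.sup {U W : Submodule (ZMod 2) V} (hU : Contains Q U) (hW : Contains Q W)
    (h : ∀ u ∈ U, ∀ w ∈ W, polar Q u w = 0) : Contains Q (U ⊔ W) := by
  intro v hv
  obtain ⟨u, hu, w, hw, rfl⟩ := Submodule.mem_sup.1 hv
  rw [QuadraticMap.map_add Q, hU u hu, hW w hw, h u hu w hw]
  simp

lemma Contains.sup_span_singleton {W : Submodule (ZMod 2) V} (hW : Contains Q W) {v : V}
    (hv : Q v = 0) (h : ∀ w ∈ W, polar Q w v = 0) : Contains Q (W ⊔ (ZMod 2) ∙ v) := by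
  refine hW.sup (contains_span_singleton hv) fun u hu w hw => ?_
  obtain ⟨c, rfl⟩ := Submodule.mem_span_singleton.1 hw
  simp [h u hu]

lemma IsNonsingular.eq_zero (hQ : IsNonsingular Q) {v : V} (hv : Q v = 0)
    (h : ∀ w, polar Q v w = 0) : v = 0 := by
  rw [IsNonsingular] at hQ
  have : v ∈ Q.radical := ⟨hv, LinearMap.ext fun w => by simpa using h w⟩
  simpa [hQ] using this

/-- The orthogonal of the orthogonal of `W` is `W + ker B`: a vector outside the latter pairs
nontrivially with some vector orthogonal to `W`. -/
lemma exists_polar_eq_one [Finite V] {W : Submodule (ZMod 2) V} {y : V}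
    (h : ∀ w ∈ W, ∃ v, polar Q (y + w) v ≠ 0) :
    ∃ b, (∀ w ∈ W, polar Q b w = 0) ∧ polar Q b y = 1 := by
  by_contra! hb
  have key := mem_span_of_iInf_ker_le_ker (𝕜 := ZMod 2) (E := V)
    (L := fun w : W => Q.polarBilin w) (K := Q.polarBilin y) fun b hb' => by
      simp only [Submodule.mem_iInf, LinearMap.mem_ker, polarBilin_apply_apply] at hb' ⊢
      by_contra hne
      refine hb b (fun w hw => ?_) ?_
      · rw [polar_comm]; exact hb' ⟨w, hw⟩
      · rw [polar_comm]; exact eq_one_of_ne_zero hne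
  have hrange : Submodule.span (ZMod 2) (Set.range fun w : W => Q.polarBilin w) =
      W.map Q.polarBilin := by
    rw [← Submodule.span_eq (W.map Q.polarBilin)]
    congr 1
    ext f
    simp
  rw [hrange] at key
  obtain ⟨w, hw, hwy⟩ := key
  obtain ⟨v, hv⟩ := h w hw
  apply hv
  have := LinearMap.congr_fun hwy v
  simp only [polarBilin_apply_apply] at this
  rw [polar_add_left, this]
  exact CharTwo.add_self_eq_zero _

lemma exists_polar_eq_one_of_contains [Finite V] (hQ : IsNonsingular Q)
    {W : Submodule (ZMod 2) V} (hW : Contains Q W) {y : V} (hy : Q y = 0)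
    (hyW : ∀ w ∈ W, polar Q w y = 0) (hmem : y ∉ W) :
    ∃ b, (∀ w ∈ W, polar Q b w = 0) ∧ polar Q b y = 1 := by
  refine exists_polar_eq_one fun w hw => ?_
  by_contra! h
  have h0 : y + w = 0 := hQ.eq_zero (by
    rw [QuadraticMap.map_add Q, hy, hW w hw, polar_comm, hyW w hw]; simp) h
  rw [add_eq_zero_iff_eq_neg] at h0
  exact hmem (h0 ▸ W.neg_mem hw)

lemma exists_polar_eq_zero_one [Finite V] (hQ : IsNonsingular Q) {c y : V} (hc : Q c = 0)
    (hy : Q y = 0) (hcy : polar Q c y = 0) (hy0 : y ≠ 0) (hne : y ≠ c) :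
    ∃ b, polar Q b c = 0 ∧ polar Q b y = 1 := by
  obtain ⟨b, hb, hb'⟩ := exists_polar_eq_one_of_contains hQ (contains_span_singleton hc) hy
    (fun w hw => by
      obtain ⟨k, rfl⟩ := Submodule.mem_span_singleton.1 hw
      simp [hcy]) (fun hmem => by
      obtain ⟨k, rfl⟩ := Submodule.mem_span_singleton.1 hmem
      rcases ((by decide : ∀ k : ZMod 2, k = 0 ∨ k = 1) k) with rfl | rfl
      · simp at hy0
      · simp at hne)
  exact ⟨b, hb c (Submodule.mem_span_singleton_self c), hb'⟩

/-- Of `b` and `b + a`, one is singular when `B(b, a) = 1`. -/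
lemma exists_singular_of_polar_eq_one {a b : V} (ha : Q a = 0) (hba : polar Q b a = 1) :
    ∃ c, Q c = 0 ∧ ∀ v, polar Q a v = 0 → polar Q c v = polar Q b v := by
  by_cases hb : Q b = 0
  · exact ⟨b, hb, fun _ _ => rfl⟩
  · refine ⟨b + a, ?_, fun v hv => by rw [polar_add_left, hv, add_zero]⟩
    rw [QuadraticMap.map_add Q, eq_one_of_ne_zero hb, ha, hba]
    rfl

/-- Two nonzero linear forms on a binary space take the value `1` simultaneously. -/
lemma exists_polar_eq_one_and {W : Submodule (ZMod 2) V} {y z : V}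
    (hy : ∃ a ∈ W, polar Q y a ≠ 0) (hz : ∃ a ∈ W, polar Q z a ≠ 0) :
    ∃ a ∈ W, polar Q y a = 1 ∧ polar Q z a = 1 := by
  obtain ⟨a, ha, hya⟩ := hy
  obtain ⟨b, hb, hzb⟩ := hz
  have hya := eq_one_of_ne_zero hya
  have hzb := eq_one_of_ne_zero hzb
  by_cases hza : polar Q z a = 0
  · by_cases hyb : polar Q y b = 0
    · exact ⟨a + b, W.add_mem ha hb, by simp [*], by simp [*]⟩
    · exact ⟨b, hb, eq_one_of_ne_zero hyb, hzb⟩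
  · exact ⟨a, ha, hya, eq_one_of_ne_zero hza⟩

/-- A subspace of dimension at least two contains a nonzero vector orthogonal to a given one. -/
lemma exists_ne_zero_polar_eq_zero [Finite V] {W : Submodule (ZMod 2) V}
    (hW : 2 ≤ Module.finrank (ZMod 2) W) (y : V) : ∃ a ∈ W, a ≠ 0 ∧ polar Q y a = 0 := by
  have : LinearMap.ker ((Q.polarBilin y).domRestrict W) ≠ ⊥ := by
    intro h
    have := LinearMap.finrank_le_finrank_of_injective (LinearMap.ker_eq_bot.1 h)
    simp at this
    omega
  obtain ⟨a, ha, ha0⟩ := Submodule.exists_mem_ne_zero_of_ne_bot this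
  exact ⟨a, a.2, by simpa using ha0, by simpa using ha⟩

/-- If some totally singular subspace has larger dimension than `W`, then a singular vector outside
`W` is orthogonal to `W`. This is the part of Witt's theorem on maximal totally singular subspaces
that shows that there are points of type (ii). -/
lemma exists_singular_orthogonal_notMem [Finite V] {W U : Submodule (ZMod 2) V}
    (hU : Contains Q U)
    (h : Module.finrank (ZMod 2) W < Module.finrank (ZMod 2) U) :
    ∃ x, x ∉ W ∧ Q x = 0 ∧ ∀ a ∈ W, polar Q a x = 0 := by
  by_contra! hx
  -- `T` is the pairing of `U` with `W`; its kernel lies in `W ∩ U`, which its range annihilates.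
  let T : U →ₗ[ZMod 2] Module.Dual (ZMod 2) W :=
    (LinearMap.domRestrict₁₂ Q.polarBilin U W)
  let N : Submodule (ZMod 2) W := U.comap W.subtype
  have hker : Module.finrank (ZMod 2) (LinearMap.ker T) ≤ Module.finrank (ZMod 2) N := by
    let f : LinearMap.ker T →ₗ[ZMod 2] V := U.subtype ∘ₗ (LinearMap.ker T).subtype
    have hf : ∀ u, f u ∈ W := fun u => by
      by_contra hu
      obtain ⟨a, ha, hne⟩ := hx _ hu (hU _ u.1.2)
      have : polar Q (f u) a = 0 := LinearMap.congr_fun (LinearMap.mem_ker.1 u.2) ⟨a, ha⟩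
      exact hne (by rwa [polar_comm])
    refine LinearMap.finrank_le_finrank_of_injective
      (f := (f.codRestrict W hf).codRestrict N fun u => u.1.2) fun u v huv => ?_
    have : f u = f v := congrArg (fun t : N => (t : V)) huv
    exact Subtype.ext (Subtype.ext this)
  have hrange : LinearMap.range T ≤ N.dualAnnihilator := by
    rintro _ ⟨u, rfl⟩
    rw [Submodule.mem_dualAnnihilator]
    intro a ha
    exact hU.polar_eq_zero u.2 ha
  have h1 := LinearMap.finrank_range_add_finrank_ker T
  have h2 := Subspace.finrank_add_finrank_dualAnnihilator_eq N
  have h3 := Submodule.finrank_mono hrange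
  omega

/-! ### Isometries -/

/-- The reflection `v ↦ v + B(v, u) u` in a vector `u`. -/
def reflection (Q : QuadraticForm (ZMod 2) V) (u : V) : V →ₗ[ZMod 2] V :=
  LinearMap.id + (Q.polarBilin u).smulRight u

lemma reflection_apply (u v : V) : reflection Q u v = v + polar Q v u • u := by
  simp [reflection, polar_comm Q u v]

lemma map_reflection {u : V} (hu : Q u = 1) (v : V) : Q (reflection Q u v) = Q v := by
  rw [reflection_apply, QuadraticMap.map_add Q, QuadraticMap.map_smul, hu, polar_smul_right]
  generalize polar Q v u = x
  generalize Q v = y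
  revert x y
  decide

/-- The Siegel transformation `v ↦ v + B(v, a) b + (B(v, b) + Q(b) B(v, a)) a`, for a singular
vector `a` and a vector `b` orthogonal to it. -/
def siegel (Q : QuadraticForm (ZMod 2) V) (a b : V) : V →ₗ[ZMod 2] V :=
  LinearMap.id + (Q.polarBilin a).smulRight b +
    (Q.polarBilin b + Q b • Q.polarBilin a).smulRight a

lemma siegel_apply (a b v : V) : siegel Q a b v =
    v + polar Q v a • b + (polar Q v b + Q b * polar Q v a) • a := by
  rw [polar_comm Q v a, polar_comm Q v b]
  simp [siegel]

lemma map_siegel {a b : V} (ha : Q a = 0) (hab : polar Q a b = 0) (v : V) :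
    Q (siegel Q a b v) = Q v := by
  rw [siegel_apply]
  simp only [QuadraticMap.map_add Q, QuadraticMap.map_smul, ha, polar_smul_right, polar_add_left,
    polar_smul_left, polar_comm Q b a, hab]
  generalize polar Q v a = x
  generalize polar Q v b = y
  generalize Q v = z
  generalize Q b = t
  revert x y z t
  decide

lemma siegel_apply_of_polar_eq_one {c b x : V} (hxc : polar Q x c = 0) (hxb : polar Q b x = 1) :
    siegel Q c b x = x + c := by
  rw [polar_comm] at hxb
  simp [siegel_apply, hxc, hxb]

/-- When also `B(z, a) = 1`, the map is an isometry (`map_siegel`), so singular vectors that are not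
orthogonal to `a` are conjugate under the Siegel transformations of `a`. -/
lemma siegel_add_apply {a y z : V} (hy : Q y = 0) (hz : Q z = 0) (hya : polar Q y a = 1) :
    siegel Q a (y + z) y = z := by
  have h : polar Q y z + polar Q y z = 0 := CharTwo.add_self_eq_zero _
  rw [siegel_apply, hya, QuadraticMap.map_add Q, hy, hz, polar_add_right, polar_self_eq_zero]
  simp [h, ← add_assoc, ZModModule.add_self]

end Quadric

/-! ### The binary form of a graph -/

namespace SimpleGraph

variable {W : Type*} (G : SimpleGraph W)

open Classical in
/-- The binary form of a graph: `0` on pairs of equal or adjacent vertices, `1` on all others. For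
the point-graph of a binary quadric it is the polar form. -/
noncomputable def binaryForm (x y : W) : ZMod 2 :=
  if x = y ∨ G.Adj x y then 0 else 1

variable {G}

lemma binaryForm_eq_zero_iff {x y : W} : G.binaryForm x y = 0 ↔ x = y ∨ G.Adj x y := by
  simp only [binaryForm, ite_eq_left_iff, one_ne_zero, imp_false, not_not]

lemma adj_iff_binaryForm {x y : W} : G.Adj x y ↔ x ≠ y ∧ G.binaryForm x y = 0 := by
  rw [binaryForm_eq_zero_iff]
  constructor
  · exact fun h => ⟨h.ne, Or.inr h⟩
  · rintro ⟨h, h' | h'⟩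
    · exact absurd h' h
    · exact h'

lemma binaryForm_apply_of_mem_autGroup {φ : Equiv.Perm W} (hφ : φ ∈ G.autGroup) (x y : W) :
    G.binaryForm (φ x) (φ y) = G.binaryForm x y := by
  refine Quadric.eq_of_eq_zero_iff ?_
  rw [binaryForm_eq_zero_iff, binaryForm_eq_zero_iff]
  exact or_congr φ.injective.eq_iff (hφ x y)

variable (G) in
/-- Every edge through `p` extends to a triple of vertices whose rows in the binary form sum to
zero. In the point-graph of a quadric these triples are the lines. -/
def IsCentral (p : W) : Prop :=
  ∀ q, G.Adj p q → ∃ w, ∀ z, G.binaryForm p z + G.binaryForm q z + G.binaryForm w z = 0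

lemma IsCentral.apply {φ : Equiv.Perm W} (hφ : φ ∈ G.autGroup) {p : W} (hp : G.IsCentral p) :
    G.IsCentral (φ p) := by
  intro q hq
  obtain ⟨q, rfl⟩ := φ.surjective q
  obtain ⟨w, hw⟩ := hp q ((hφ p q).1 hq)
  refine ⟨φ w, fun z => ?_⟩
  obtain ⟨z, rfl⟩ := φ.surjective z
  simpa [binaryForm_apply_of_mem_autGroup hφ] using hw z

end SimpleGraph

namespace Quadric

open QuadraticMap

variable {V : Type*} [AddCommGroup V] [Module (ZMod 2) V] {Q : QuadraticForm (ZMod 2) V}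

/-! ### Points as vectors -/

/-- The unique nonzero vector of a point of a binary quadric. -/
noncomputable def vec (p : Point Q) : V := p.1.rep

/-- The point of a nonzero singular vector. -/
def ofVec (v : V) (hv : v ≠ 0) (hQv : Q v = 0) : Point Q :=
  ⟨Projectivization.mk (ZMod 2) v hv, by
    rw [Projectivization.submodule_mk]; exact contains_span_singleton hQv⟩

lemma submodule_eq_span_vec (p : Point Q) : p.1.submodule = (ZMod 2) ∙ vec p :=
  Projectivization.submodule_eq p.1

lemma vec_ne_zero (p : Point Q) : vec p ≠ 0 := p.1.rep_nonzero

lemma map_vec (p : Point Q) : Q (vec p) = 0 :=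
  p.2 _ (by rw [submodule_eq_span_vec]; exact Submodule.mem_span_singleton_self _)

lemma vec_ofVec {v : V} (hv : v ≠ 0) (hQv : Q v = 0) : vec (ofVec v hv hQv) = v := by
  obtain ⟨a, ha⟩ := Projectivization.exists_smul_eq_mk_rep (ZMod 2) v hv
  have h1 : a = 1 := Subsingleton.elim _ _
  rw [h1, one_smul] at ha
  exact ha.symm

lemma vec_injective : Function.Injective (vec : Point Q → V) := fun p q h =>
  Subtype.ext <| Projectivization.submodule_injective <| by
    rw [submodule_eq_span_vec, submodule_eq_span_vec, h]

lemma exists_vec_eq {v : V} (hv : v ≠ 0) (hQv : Q v = 0) : ∃ p : Point Q, vec p = v :=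
  ⟨_, vec_ofVec hv hQv⟩

lemma pointGraph_adj {p r : Point Q} :
    (pointGraph Q).Adj p r ↔ p ≠ r ∧ polar Q (vec p) (vec r) = 0 := by
  refine and_congr_right fun _ => ?_
  rw [submodule_eq_span_vec, submodule_eq_span_vec]
  constructor
  · exact fun h => h.polar_eq_zero (Submodule.mem_sup_left (Submodule.mem_span_singleton_self _))
      (Submodule.mem_sup_right (Submodule.mem_span_singleton_self _))
  · intro h
    refine (contains_span_singleton (map_vec p)).sup_span_singleton (map_vec r) fun w hw => ?_
    obtain ⟨k, rfl⟩ := Submodule.mem_span_singleton.1 hw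
    simp [h]

lemma binaryForm_pointGraph (p r : Point Q) :
    (pointGraph Q).binaryForm p r = polar Q (vec p) (vec r) := by
  refine eq_of_eq_zero_iff ?_
  rw [SimpleGraph.binaryForm_eq_zero_iff, pointGraph_adj]
  constructor
  · rintro (rfl | h)
    · exact polar_self_eq_zero _
    · exact h.2
  · intro h
    by_cases hpr : p = r
    · exact Or.inl hpr
    · exact Or.inr ⟨hpr, h⟩

variable {α : Submodule (ZMod 2) V}

lemma mem_typeOne {p : Point Q} : p ∈ typeOne Q α ↔ vec p ∈ α := by
  rw [typeOne, Set.mem_ofPred_eq, submodule_eq_span_vec, Submodule.span_singleton_le_iff_mem]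

lemma mem_typeTwo [Finite V] (hα : Contains Q α) {p : Point Q} :
    p ∈ typeTwo Q α ↔ vec p ∉ α ∧ ∀ a ∈ α, polar Q (vec p) a = 0 := by
  rw [typeTwo, Set.mem_ofPred_eq, mem_typeOne]
  refine and_congr_right fun hp => ?_
  simp only [submodule_eq_span_vec, Submodule.span_singleton_le_iff_mem]
  constructor
  · rintro ⟨U, -, hαU, hU, hpU⟩ a ha
    exact hU.polar_eq_zero hpU (hαU ha)
  · intro h
    refine ⟨α ⊔ (ZMod 2) ∙ vec p, Submodule.finrank_sup_span_singleton hp, le_sup_left,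
      hα.sup_span_singleton (map_vec p) fun w hw => ?_,
      Submodule.mem_sup_right (Submodule.mem_span_singleton_self _)⟩
    rw [polar_comm]
    exact h w hw

lemma mem_typeThree [Finite V] (hα : Contains Q α) {p : Point Q} :
    p ∈ typeThree Q α ↔ ∃ a ∈ α, polar Q (vec p) a ≠ 0 := by
  rw [typeThree, Set.mem_ofPred_eq, mem_typeOne, mem_typeTwo hα]
  constructor
  · rintro ⟨h1, h2⟩
    by_contra! h
    exact h2 ⟨h1, h⟩
  · rintro ⟨a, ha, hne⟩
    exact ⟨fun h => hne (hα.polar_eq_zero h ha), fun h => hne (h.2 a ha)⟩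

lemma notMem_typeThree [Finite V] (hα : Contains Q α) {p : Point Q} :
    p ∉ typeThree Q α ↔ ∀ a ∈ α, polar Q (vec p) a = 0 := by
  rw [mem_typeThree hα]
  push Not
  rfl

lemma exists_typeTwo_vec_eq_add [Finite V] (hα : Contains Q α) {x : Point Q}
    (hx : x ∈ typeTwo Q α) {a : V} (ha : a ∈ α) : ∃ x' ∈ typeTwo Q α, vec x' = vec x + a := by
  obtain ⟨h1, h2⟩ := (mem_typeTwo hα).1 hx
  have hmem : vec x + a ∉ α := fun h => h1 ((Submodule.add_mem_iff_left α ha).1 h)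
  obtain ⟨x', hx'⟩ := exists_vec_eq (Q := Q) (v := vec x + a)
    (fun h => hmem (h ▸ α.zero_mem)) (by
      rw [QuadraticMap.map_add Q, map_vec, hα a ha, h2 a ha]; simp)
  refine ⟨x', (mem_typeTwo hα).2 ⟨hx' ▸ hmem, fun b hb => ?_⟩, hx'⟩
  rw [hx', polar_add_left, h2 b hb, hα.polar_eq_zero ha hb, add_zero]

/-! ### The switched graph -/

/-- The vertices that are half-adjacent to the points of type (ii) are those of type (iii): for such
a point `y` and `a ∈ α` not orthogonal to `y`, translation by `a` interchanges the neighbours and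
the non-neighbours of `y` among the points of type (ii). -/
lemma isHalfAdjacent_iff [Finite V] (hα : Contains Q α) (hne : (typeTwo Q α).Nonempty)
    {y : Point Q} : (pointGraph Q).IsHalfAdjacent (typeTwo Q α) y ↔ y ∈ typeThree Q α := by
  constructor
  · rintro ⟨hy, hcard⟩
    refine ⟨fun h1 => ?_, hy⟩
    have hsub : (pointGraph Q).neighborSet y ∩ typeTwo Q α = typeTwo Q α := by
      refine Set.inter_eq_right.2 fun x hx => pointGraph_adj.2 ⟨?_, ?_⟩
      · rintro rfl; exact hy hx
      · rw [polar_comm]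
        exact ((mem_typeTwo hα).1 hx).2 _ (mem_typeOne.1 h1)
    rw [hsub] at hcard
    have := (Set.ncard_pos (Set.toFinite _)).2 hne
    omega
  · intro hy
    refine ⟨hy.2, ?_⟩
    obtain ⟨a, ha, hya⟩ := (mem_typeThree hα).1 hy
    have htr : ∀ x : Point Q, x ∈ typeTwo Q α → ∃ x' ∈ typeTwo Q α, vec x' = vec x + a :=
      fun x hx => exists_typeTwo_vec_eq_add hα hx ha
    choose! τ hτ hτv using htr
    have hflip : ∀ x ∈ typeTwo Q α, polar Q (vec y) (vec (τ x)) = polar Q (vec y) (vec x) + 1 := by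
      intro x hx
      rw [hτv x hx, polar_add_right, eq_one_of_ne_zero hya]
    have hinj : Set.InjOn τ (typeTwo Q α) := fun x hx x' hx' h => vec_injective <| by
      have := congrArg vec h
      rwa [hτv x hx, hτv x' hx', add_left_inj] at this
    have hadj : ∀ x ∈ typeTwo Q α,
        ((pointGraph Q).Adj y x ↔ polar Q (vec y) (vec x) = 0) := fun x hx => by
      rw [pointGraph_adj, and_iff_right]
      rintro rfl; exact hy.2 hx
    have h01 : ∀ t : ZMod 2, t + 1 = 0 ↔ t ≠ 0 := by decide
    have h1 : ((pointGraph Q).neighborSet y ∩ typeTwo Q α).ncard ≤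
        (typeTwo Q α \ (pointGraph Q).neighborSet y).ncard := by
      refine Set.ncard_le_ncard_of_injOn τ (fun x hx => ⟨hτ x hx.2, ?_⟩)
        (hinj.mono Set.inter_subset_right) (Set.toFinite _)
      rw [SimpleGraph.mem_neighborSet, hadj _ (hτ x hx.2), hflip x hx.2, h01, not_not,
        ← hadj x hx.2]
      exact hx.1
    have h2 : (typeTwo Q α \ (pointGraph Q).neighborSet y).ncard ≤
        ((pointGraph Q).neighborSet y ∩ typeTwo Q α).ncard := by
      refine Set.ncard_le_ncard_of_injOn τ (fun x hx => ⟨?_, hτ x hx.1⟩)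
        (hinj.mono Set.sdiff_subset) (Set.toFinite _)
      rw [SimpleGraph.mem_neighborSet, hadj _ (hτ x hx.1), hflip x hx.1, h01, Ne, ← hadj x hx.1]
      exact hx.2
    have h3 := Set.ncard_inter_add_ncard_sdiff_eq_ncard (typeTwo Q α)
      ((pointGraph Q).neighborSet y) (Set.toFinite _)
    rw [Set.inter_comm] at h3
    omega

lemma switchedGraph_adj [Finite V] (hα : Contains Q α) (hne : (typeTwo Q α).Nonempty)
    {p r : Point Q} : (switchedGraph Q α).Adj p r ↔
      Xor ((pointGraph Q).Adj p r) ((p ∈ typeThree Q α ∧ r ∈ typeTwo Q α) ∨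
        (r ∈ typeThree Q α ∧ p ∈ typeTwo Q α)) := by
  rw [← isHalfAdjacent_iff hα hne, ← isHalfAdjacent_iff hα hne]
  rfl

open Classical in
/-- The indicator function of a set of points, with values in the binary field. -/
noncomputable def ind (S : Set (Point Q)) (p : Point Q) : ZMod 2 := if p ∈ S then 1 else 0

lemma ind_of_mem {S : Set (Point Q)} {p : Point Q} (h : p ∈ S) : ind S p = 1 := if_pos h

lemma ind_of_notMem {S : Set (Point Q)} {p : Point Q} (h : p ∉ S) : ind S p = 0 := if_neg h

lemma ind_congr {S : Set (Point Q)} {p q : Point Q} (h : p ∈ S ↔ q ∈ S) : ind S p = ind S q := by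
  by_cases hq : q ∈ S
  · rw [ind_of_mem hq, ind_of_mem (h.2 hq)]
  · rw [ind_of_notMem hq, ind_of_notMem (mt h.1 hq)]

/-- Switching adds to the polar form the symmetric form that pairs points of type (ii) with points
of type (iii). -/
lemma binaryForm_switchedGraph [Finite V] (hα : Contains Q α) (hne : (typeTwo Q α).Nonempty)
    (p r : Point Q) : (switchedGraph Q α).binaryForm p r = polar Q (vec p) (vec r) +
      ind (typeTwo Q α) p * ind (typeThree Q α) r + ind (typeThree Q α) p * ind (typeTwo Q α) r := by
  rw [← binaryForm_pointGraph]
  have hp : p ∈ typeTwo Q α → p ∉ typeThree Q α := fun h h' => h'.2 h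
  have hr : r ∈ typeTwo Q α → r ∉ typeThree Q α := fun h h' => h'.2 h
  have hs := switchedGraph_adj hα hne (p := p) (r := r)
  simp only [SimpleGraph.binaryForm, ind]
  have h11 : (1 : ZMod 2) + 1 = 0 := rfl
  by_cases h2p : p ∈ typeTwo Q α <;> by_cases h2r : r ∈ typeTwo Q α <;>
    by_cases h3p : p ∈ typeThree Q α <;> by_cases h3r : r ∈ typeThree Q α <;>
    by_cases hpr : p = r <;> by_cases hadj : (pointGraph Q).Adj p r <;>
    simp_all [Xor]

lemma switchedGraph_adj_of_mem_typeOne [Finite V] (hα : Contains Q α) (hne : (typeTwo Q α).Nonempty)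
    {p r : Point Q} (hp : p ∈ typeOne Q α) :
    (switchedGraph Q α).Adj p r ↔ (pointGraph Q).Adj p r := by
  have h2 : p ∉ typeTwo Q α := fun h => h.1 hp
  have h3 : p ∉ typeThree Q α := fun h => h.1 hp
  simp [switchedGraph_adj hα hne, h2, h3, Xor]

/-! ### Points of type (i) are the central points of the switched graph -/

lemma add_eq_of_add_add_eq_zero {u v w : V} (h : u + v + w = 0) : u + v = w := by
  rw [add_eq_zero_iff_eq_neg, ZModModule.neg_eq_self] at h
  exact h

/-- Every point of type (iii) lies on a line of the quadric all of whose points are of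
type (iii). -/
lemma exists_typeThree_line [Finite V] (hQ : IsNonsingular Q) (hα : Contains Q α)
    (hdim : 2 ≤ Module.finrank (ZMod 2) α) {p : Point Q} (hp : p ∈ typeThree Q α) :
    ∃ q ∈ typeThree Q α, ∃ r ∈ typeThree Q α,
      polar Q (vec p) (vec q) = 0 ∧ vec p + vec q + vec r = 0 := by
  obtain ⟨a₀, ha₀, hpa₀⟩ := (mem_typeThree hα).1 hp
  obtain ⟨a, ha, ha0, hpa⟩ := exists_ne_zero_polar_eq_zero (Q := Q) hdim (vec p)
  have hap : a ≠ vec p := by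
    rintro rfl
    exact hpa₀ (hα.polar_eq_zero ha ha₀)
  obtain ⟨b, hbp, hba⟩ := exists_polar_eq_zero_one hQ (map_vec p) (hα a ha) hpa ha0 hap
  obtain ⟨c, hc, hcb⟩ := exists_singular_of_polar_eq_one (hα a ha) hba
  have hcp : polar Q c (vec p) = 0 := by rw [hcb _ (by rw [polar_comm, hpa]), hbp]
  have hca : polar Q c a = 1 := by rw [hcb _ (polar_self_eq_zero a), hba]
  obtain ⟨r, rfl⟩ := exists_vec_eq (Q := Q) (v := c) (by rintro rfl; simp at hca) hc
  have hpca : polar Q (vec p + vec r) a = 1 := by rw [polar_add_left, hpa, hca, zero_add]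
  have hpr : polar Q (vec p) (vec r) = 0 := by rw [polar_comm, hcp]
  obtain ⟨q, hq⟩ := exists_vec_eq (Q := Q) (v := vec p + vec r)
    (by intro h; simp [h] at hpca) (by
      rw [QuadraticMap.map_add Q, map_vec, map_vec, hpr]; simp)
  refine ⟨q, (mem_typeThree hα).2 ⟨a, ha, ?_⟩, r, (mem_typeThree hα).2 ⟨a, ha, ?_⟩, ?_, ?_⟩
  · rw [hq, hpca]; exact one_ne_zero
  · rw [hca]; exact one_ne_zero
  · rw [hq, polar_add_right, polar_self_eq_zero, hpr, add_zero]
  · rw [hq, ← add_assoc, ZModModule.add_self, zero_add, ZModModule.add_self]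

/-- Every point of type (ii) is non-orthogonal to some point of type (iii). -/
lemma exists_typeThree_polar_eq_one [Finite V] (hQ : IsNonsingular Q) (hα : Contains Q α)
    (hα0 : α ≠ ⊥) {p : Point Q} (hp : p ∈ typeTwo Q α) :
    ∃ q ∈ typeThree Q α, polar Q (vec p) (vec q) = 1 := by
  obtain ⟨hpα, hporth⟩ := (mem_typeTwo hα).1 hp
  obtain ⟨a, ha, ha0⟩ := Submodule.exists_mem_ne_zero_of_ne_bot hα0
  obtain ⟨b, hb, hba⟩ := exists_polar_eq_zero_one hQ (c := vec p + a) (y := a)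
    (by rw [QuadraticMap.map_add Q, map_vec, hα a ha, hporth a ha]; simp) (hα a ha)
    (by rw [polar_add_left, hporth a ha, hα.polar_eq_zero ha ha, add_zero]) ha0
    (by simpa using vec_ne_zero p)
  have hbp : polar Q b (vec p) = 1 := by
    rw [polar_add_right, hba] at hb
    exact (by decide : ∀ x : ZMod 2, x + 1 = 0 → x = 1) _ hb
  obtain ⟨c, hc, hcb⟩ := exists_singular_of_polar_eq_one (hα a ha) hba
  have hcp : polar Q c (vec p) = 1 := by rw [hcb _ (by rw [polar_comm, hporth a ha]), hbp]
  have hca : polar Q c a = 1 := by rw [hcb _ (polar_self_eq_zero a), hba]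
  obtain ⟨q, rfl⟩ := exists_vec_eq (Q := Q) (v := c) (by rintro rfl; simp at hca) hc
  refine ⟨q, (mem_typeThree hα).2 ⟨a, ha, ?_⟩, ?_⟩
  · rw [hca]; exact one_ne_zero
  · rw [polar_comm, hcp]

/-- The indicator function of the points of type (iii) is not linear: a linear function takes the
value `1` an even number of times on a line. -/
lemma polar_ne_ind_typeThree [Finite V] (hQ : IsNonsingular Q) (hα : Contains Q α)
    (hdim : 2 ≤ Module.finrank (ZMod 2) α) (hne : (typeThree Q α).Nonempty) (t : V) :
    ¬ ∀ z : Point Q, polar Q t (vec z) = ind (typeThree Q α) z := by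
  intro h
  obtain ⟨p, hp⟩ := hne
  obtain ⟨q, hq, r, hr, -, hsum⟩ := exists_typeThree_line hQ hα hdim hp
  have := congrArg (polar Q t) hsum
  rw [polar_add_right, polar_add_right, h, h, h, ind_of_mem hp, ind_of_mem hq,
    ind_of_mem hr, polar_zero_right] at this
  exact absurd this (by decide)

/-- The indicator function of the points of type (ii) is not linear: some line has one point of
type (ii) and two of type (iii). -/
lemma polar_ne_ind_typeTwo [Finite V] (hα : Contains Q α)
    (h2 : (typeTwo Q α).Nonempty) (h3 : (typeThree Q α).Nonempty) (t : V) :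
    ¬ ∀ z : Point Q, polar Q t (vec z) = ind (typeTwo Q α) z := by
  intro h
  obtain ⟨x, hx⟩ := h2
  obtain ⟨y, hy⟩ := h3
  obtain ⟨a, ha, hya⟩ := (mem_typeThree hα).1 hy
  have hya1 := eq_one_of_ne_zero hya
  -- One of `x` and `x + a` is orthogonal to `y`.
  obtain ⟨c, hc, hcy⟩ : ∃ c ∈ typeTwo Q α, polar Q (vec c) (vec y) = 0 := by
    by_cases hxy : polar Q (vec x) (vec y) = 0
    · exact ⟨x, hx, hxy⟩
    obtain ⟨c, hc, hcx⟩ := exists_typeTwo_vec_eq_add hα hx ha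
    refine ⟨c, hc, ?_⟩
    rw [hcx, polar_add_left, eq_one_of_ne_zero hxy, polar_comm, hya1]; rfl
  obtain ⟨-, hcorth⟩ := (mem_typeTwo hα).1 hc
  have hcya : polar Q (vec c + vec y) a = 1 := by
    rw [polar_add_left, hcorth a ha, hya1, zero_add]
  obtain ⟨r, hr⟩ := exists_vec_eq (Q := Q) (v := vec c + vec y)
    (by intro h; simp [h] at hcya) (by rw [QuadraticMap.map_add Q, map_vec, map_vec, hcy]; simp)
  have hr3 : r ∈ typeThree Q α :=
    (mem_typeThree hα).2 ⟨a, ha, by rw [hr, hcya]; exact one_ne_zero⟩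
  have := h r
  rw [hr, polar_add_right, h, h, ind_of_mem hc, ind_of_notMem hy.2, ind_of_notMem hr3.2] at this
  exact absurd this (by decide)

lemma ind_of_vec_mem {z : Point Q} (hz : vec z ∈ α) :
    ind (typeTwo Q α) z = 0 ∧ ind (typeThree Q α) z = 0 :=
  ⟨ind_of_notMem fun h => h.1 (mem_typeOne.2 hz), ind_of_notMem fun h => h.1 (mem_typeOne.2 hz)⟩

/-- The lines of the quadric that meet `α` survive the switching, and through each point outside `α`
there is an edge of the switched graph that lies on no such line. -/
theorem isCentral_switchedGraph_iff [Finite V] (hQ : IsNonsingular Q) (hα : Contains Q α)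
    (hdim : 2 ≤ Module.finrank (ZMod 2) α) (hne : (typeTwo Q α).Nonempty) {p : Point Q} :
    (switchedGraph Q α).IsCentral p ↔ p ∈ typeOne Q α := by
  have hα0 : α ≠ ⊥ := by rintro rfl; simp at hdim
  have hne3 : (typeThree Q α).Nonempty := by
    obtain ⟨x, hx⟩ := hne
    obtain ⟨q, hq, -⟩ := exists_typeThree_polar_eq_one hQ hα hα0 hx
    exact ⟨q, hq⟩
  have two : ∀ x : ZMod 2, x + x = 0 := CharTwo.add_self_eq_zero
  constructor
  · intro hcen
    by_contra hp1
    by_cases hp2 : p ∈ typeTwo Q α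
    · have hp3 : p ∉ typeThree Q α := fun h => h.2 hp2
      obtain ⟨q, hq, hpq⟩ := exists_typeThree_polar_eq_one hQ hα hα0 hp2
      obtain ⟨w, hw⟩ := hcen q (SimpleGraph.adj_iff_binaryForm.2 ⟨by rintro rfl; exact hp3 hq, by
        rw [binaryForm_switchedGraph hα hne, hpq, ind_of_mem hp2, ind_of_mem hq,
          ind_of_notMem hp3, zero_mul]; rfl⟩)
      simp only [binaryForm_switchedGraph hα hne, ind_of_mem hp2, ind_of_mem hq,
          ind_of_notMem hp3, ind_of_notMem hq.2] at hw
      by_cases hw3 : w ∈ typeThree Q α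
      · refine polar_ne_ind_typeThree hQ hα hdim hne3 (vec p + vec q + vec w) fun z => ?_
        have := hw z
        rw [ind_of_mem hw3, ind_of_notMem hw3.2] at this
        rw [polar_add_left, polar_add_left]
        linear_combination this - two (ind (typeTwo Q α) z) - two (ind (typeThree Q α) z)
      · obtain ⟨a, ha, hqa⟩ := (mem_typeThree hα).1 hq
        obtain ⟨z, rfl⟩ := exists_vec_eq (Q := Q) (v := a) (by rintro rfl; simp at hqa) (hα a ha)
        have := hw z
        rw [(ind_of_vec_mem ha).1, (ind_of_vec_mem ha).2,
          (notMem_typeThree hα).1 hp3 _ ha, (notMem_typeThree hα).1 hw3 _ ha] at this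
        exact hqa (by simpa using this)
    · have hp3 : p ∈ typeThree Q α := ⟨hp1, hp2⟩
      obtain ⟨q, hq, r, hr, hpq, hsum⟩ := exists_typeThree_line hQ hα hdim hp3
      have hpqr := add_eq_of_add_add_eq_zero hsum
      obtain ⟨w, hw⟩ := hcen q (SimpleGraph.adj_iff_binaryForm.2 ⟨by
        rintro rfl
        rw [ZModModule.add_self] at hpqr
        exact vec_ne_zero r hpqr.symm, by
        rw [binaryForm_switchedGraph hα hne, hpq, ind_of_notMem hp2, ind_of_notMem hq.2]
        simp⟩)
      simp only [binaryForm_switchedGraph hα hne, ind_of_mem hp3, ind_of_mem hq,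
          ind_of_notMem hp2, ind_of_notMem hq.2] at hw
      by_cases hw3 : w ∈ typeThree Q α
      · refine polar_ne_ind_typeTwo hα hne hne3 (vec p + vec q + vec w) fun z => ?_
        have := hw z
        rw [ind_of_mem hw3, ind_of_notMem hw3.2] at this
        rw [polar_add_left, polar_add_left]
        linear_combination this - 2 * two (ind (typeTwo Q α) z)
      · obtain ⟨a, ha, hra⟩ := (mem_typeThree hα).1 hr
        obtain ⟨z, rfl⟩ := exists_vec_eq (Q := Q) (v := a) (by rintro rfl; simp at hra) (hα a ha)
        have := hw z
        rw [(ind_of_vec_mem ha).1, (ind_of_vec_mem ha).2,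
          (notMem_typeThree hα).1 hw3 _ ha] at this
        rw [← hpqr, polar_add_left] at hra
        exact hra (by simpa using this)
  · intro hp q hpq
    have hp' := mem_typeOne.1 hp
    obtain ⟨hpq', h0⟩ := pointGraph_adj.1 ((switchedGraph_adj_of_mem_typeOne hα hne hp).1 hpq)
    obtain ⟨w, hw⟩ := exists_vec_eq (Q := Q) (v := vec p + vec q) (fun h => hpq' (by
      rw [add_eq_zero_iff_eq_neg, ZModModule.neg_eq_self] at h
      exact vec_injective h)) (by rw [QuadraticMap.map_add Q, map_vec, map_vec, h0]; simp)
    have hiff3 : w ∈ typeThree Q α ↔ q ∈ typeThree Q α := by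
      rw [mem_typeThree hα, mem_typeThree hα]
      refine exists_congr fun a => and_congr_right fun ha => ?_
      rw [hw, polar_add_left, hα.polar_eq_zero hp' ha, zero_add]
    have hiff1 : w ∈ typeOne Q α ↔ q ∈ typeOne Q α := by
      rw [mem_typeOne, mem_typeOne, hw, Submodule.add_mem_iff_right _ hp']
    have hiff2 : w ∈ typeTwo Q α ↔ q ∈ typeTwo Q α := by
      have h (x : Point Q) : x ∈ typeTwo Q α ↔ x ∉ typeOne Q α ∧ x ∉ typeThree Q α :=
        ⟨fun h => ⟨h.1, fun h' => h'.2 h⟩, fun h => by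
          by_contra h'
          exact h.2 ⟨h.1, h'⟩⟩
      rw [h, h, hiff1, hiff3]
    have e2 : ind (typeTwo Q α) w = ind (typeTwo Q α) q := ind_congr hiff2
    have e3 : ind (typeThree Q α) w = ind (typeThree Q α) q := ind_congr hiff3
    refine ⟨w, fun z => ?_⟩
    simp only [binaryForm_switchedGraph hα hne, e2, e3, hw, polar_add_left,
      (ind_of_vec_mem hp').1, (ind_of_vec_mem hp').2]
    linear_combination two (polar Q (vec p) (vec z)) + two (polar Q (vec q) (vec z)) +
      two (ind (typeTwo Q α) q * ind (typeThree Q α) z) +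
      two (ind (typeThree Q α) q * ind (typeTwo Q α) z)

/-! ### The automorphism group of the switched graph -/

/-- The points of type (ii) are the common neighbours of the points of type (i) that are not
themselves of type (i). -/
lemma mem_typeTwo_iff_adj [Finite V] (hα : Contains Q α) {p : Point Q} :
    p ∈ typeTwo Q α ↔
      p ∉ typeOne Q α ∧ ∀ r ∈ typeOne Q α, (pointGraph Q).Adj r p := by
  rw [mem_typeTwo hα, mem_typeOne]
  refine and_congr_right fun hp => ⟨fun h r hr => ?_, fun h a ha => ?_⟩
  · rw [mem_typeOne] at hr
    refine pointGraph_adj.2 ⟨by rintro rfl; exact hp hr, ?_⟩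
    rw [polar_comm]
    exact h _ hr
  · by_cases ha0 : a = 0
    · simp [ha0]
    obtain ⟨r, rfl⟩ := exists_vec_eq ha0 (hα a ha)
    rw [polar_comm]
    exact (pointGraph_adj.1 (h r (mem_typeOne.2 ha))).2

/-- A permutation that fixes the set of points of type (i) and respects their adjacencies fixes all
three sets. -/
lemma apply_mem_type_iff [Finite V] (hα : Contains Q α) {φ : Equiv.Perm (Point Q)}
    (h1 : ∀ p, φ p ∈ typeOne Q α ↔ p ∈ typeOne Q α)
    (hadj : ∀ r ∈ typeOne Q α, ∀ p, (pointGraph Q).Adj (φ r) (φ p) ↔ (pointGraph Q).Adj r p)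
    (p : Point Q) : (φ p ∈ typeTwo Q α ↔ p ∈ typeTwo Q α) ∧
      (φ p ∈ typeThree Q α ↔ p ∈ typeThree Q α) := by
  have h2 : φ p ∈ typeTwo Q α ↔ p ∈ typeTwo Q α := by
    rw [mem_typeTwo_iff_adj hα, mem_typeTwo_iff_adj hα, h1]
    refine and_congr_right fun _ => ⟨fun h r hr => ?_, fun h r hr => ?_⟩
    · exact (hadj r hr p).1 (h _ ((h1 r).2 hr))
    · obtain ⟨r, rfl⟩ := φ.surjective r
      have hr' := (h1 r).1 hr
      exact (hadj r hr' p).2 (h r hr')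
  exact ⟨h2, and_congr (not_congr (h1 p)) (not_congr h2)⟩

theorem autGroup_switchedGraph [Finite V] (hQ : IsNonsingular Q) (hα : Contains Q α)
    (hdim : 2 ≤ Module.finrank (ZMod 2) α) (hne : (typeTwo Q α).Nonempty) :
    (switchedGraph Q α).autGroup = (pointGraph Q).autGroup ⊓
      MulAction.stabilizer (Equiv.Perm (Point Q)) (typeOne Q α) := by
  ext φ
  rw [Subgroup.mem_inf, MulAction.mem_stabilizer_set]
  constructor
  · intro hφ
    have h1 : ∀ p, φ p ∈ typeOne Q α ↔ p ∈ typeOne Q α := fun p => by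
      rw [← isCentral_switchedGraph_iff hQ hα hdim hne, ← isCentral_switchedGraph_iff hQ hα hdim hne]
      refine ⟨fun h => ?_, fun h => h.apply hφ⟩
      simpa using h.apply (inv_mem hφ)
    have h23 := apply_mem_type_iff hα h1 fun r hr p => by
      rw [← switchedGraph_adj_of_mem_typeOne hα hne hr,
        ← switchedGraph_adj_of_mem_typeOne hα hne ((h1 r).2 hr)]
      exact hφ r p
    refine ⟨fun x y => ?_, h1⟩
    have := hφ x y
    rw [switchedGraph_adj hα hne, switchedGraph_adj hα hne, (h23 x).1, (h23 x).2, (h23 y).1,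
      (h23 y).2] at this
    simp only [Xor] at this
    tauto
  · rintro ⟨hφ, h1⟩
    have h23 := apply_mem_type_iff hα h1 fun r _ p => hφ r p
    intro x y
    rw [switchedGraph_adj hα hne, switchedGraph_adj hα hne, (h23 x).1, (h23 x).2, (h23 y).1,
      (h23 y).2, hφ x y]

/-! ### Orbits -/

lemma IsNonsingular.injective_of_map_eq (hQ : IsNonsingular Q) {f : V →ₗ[ZMod 2] V}
    (hf : ∀ v, Q (f v) = Q v) : Function.Injective f := by
  rw [← LinearMap.ker_eq_bot, LinearMap.ker_eq_bot']
  intro v hv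
  refine hQ.eq_zero (by rw [← hf, hv, map_zero]) fun w => ?_
  have : polar Q (f v) (f w) = polar Q v w := by simp only [polar, ← map_add, hf]
  rw [← this, hv, polar_zero_left]

/-- A linear isometry that maps `α` into itself induces an automorphism of the point-graph that
fixes the set of points of type (i). -/
lemma exists_mem_autGroup_of_isometry [Finite V] (hQ : IsNonsingular Q)
    {f : V →ₗ[ZMod 2] V} (hf : ∀ v, Q (f v) = Q v) (hfα : ∀ a ∈ α, f a ∈ α) :
    ∃ φ ∈ (pointGraph Q).autGroup ⊓
      MulAction.stabilizer (Equiv.Perm (Point Q)) (typeOne Q α), ∀ p, vec (φ p) = f (vec p) := by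
  have hinj := hQ.injective_of_map_eq hf
  have h (p : Point Q) : ∃ q : Point Q, vec q = f (vec p) :=
    exists_vec_eq (by rw [Ne, map_eq_zero_iff f hinj]; exact vec_ne_zero p)
      (by rw [hf, map_vec])
  choose τ hτ using h
  have hτinj : Function.Injective τ := fun p q hpq => vec_injective <| hinj <| by
    rw [← hτ, ← hτ, hpq]
  refine ⟨Equiv.ofBijective τ (Finite.injective_iff_bijective.1 hτinj), ⟨fun p q => ?_, ?_⟩, hτ⟩
  · have hpol : polar Q (f (vec p)) (f (vec q)) = polar Q (vec p) (vec q) := by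
      simp only [polar, ← map_add, hf]
    rw [pointGraph_adj, pointGraph_adj, Equiv.ofBijective_apply, Equiv.ofBijective_apply,
      hτinj.ne_iff, hτ, hτ, hpol]
  · refine (MulAction.mem_stabilizer_set' (Set.toFinite _)).2 fun p hp => ?_
    rw [mem_typeOne] at hp ⊢
    exact (hτ p).symm ▸ hfα _ hp

lemma exists_mem_autGroup_of_isometry_apply [Finite V] (hQ : IsNonsingular Q)
    {f : V →ₗ[ZMod 2] V} (hf : ∀ v, Q (f v) = Q v) (hfα : ∀ a ∈ α, f a ∈ α) {p r : Point Q}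
    (hpr : f (vec p) = vec r) :
    ∃ φ ∈ (pointGraph Q).autGroup ⊓
      MulAction.stabilizer (Equiv.Perm (Point Q)) (typeOne Q α), φ p = r := by
  obtain ⟨φ, hφ, h⟩ := exists_mem_autGroup_of_isometry hQ hf hfα
  exact ⟨φ, hφ, vec_injective (by rw [h, hpr])⟩

lemma siegel_mem {a b v : V} (ha : a ∈ α) (hva : polar Q v a = 0) (hv : v ∈ α) :
    siegel Q a b v ∈ α := by
  rw [siegel_apply, hva, zero_smul, add_zero]
  exact α.add_mem hv (α.smul_mem _ ha)

lemma exists_apply_eq_of_mem_typeOne [Finite V] (hQ : IsNonsingular Q) (hα : Contains Q α)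
    {p r : Point Q} (hp : p ∈ typeOne Q α) (hr : r ∈ typeOne Q α) :
    ∃ φ ∈ (pointGraph Q).autGroup ⊓
      MulAction.stabilizer (Equiv.Perm (Point Q)) (typeOne Q α), φ p = r := by
  rw [mem_typeOne] at hp hr
  have hc := α.add_mem hp hr
  obtain ⟨b, hbc, hbp⟩ := exists_polar_eq_zero_one hQ (hα _ hc) (map_vec p)
    (hα.polar_eq_zero hc hp) (vec_ne_zero p) (by simpa using (vec_ne_zero r))
  refine exists_mem_autGroup_of_isometry_apply hQ
    (map_siegel (hα _ hc) (by rw [polar_comm, hbc]))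
    (fun a ha => siegel_mem hc (hα.polar_eq_zero ha hc) ha) ?_
  rw [siegel_apply_of_polar_eq_one (hα.polar_eq_zero hp hc) hbp, ← add_assoc,
    ZModModule.add_self, zero_add]

lemma exists_apply_eq_of_mem_typeTwo [Finite V] (hQ : IsNonsingular Q) (hα : Contains Q α)
    {p r : Point Q} (hp : p ∈ typeTwo Q α) (hr : r ∈ typeTwo Q α) :
    ∃ φ ∈ (pointGraph Q).autGroup ⊓
      MulAction.stabilizer (Equiv.Perm (Point Q)) (typeOne Q α), φ p = r := by
  obtain ⟨hpα, hporth⟩ := (mem_typeTwo hα).1 hp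
  obtain ⟨hrα, hrorth⟩ := (mem_typeTwo hα).1 hr
  have hcorth : ∀ a ∈ α, polar Q a (vec p + vec r) = 0 := fun a ha => by
    rw [polar_comm, polar_add_left, hporth a ha, hrorth a ha, add_zero]
  have hQc : Q (vec p + vec r) = polar Q (vec p) (vec r) := by
    rw [QuadraticMap.map_add Q, map_vec, map_vec]; simp
  have hpc : polar Q (vec p) (vec p + vec r) = polar Q (vec p) (vec r) := by
    rw [polar_add_right, polar_self_eq_zero, zero_add]
  by_cases h0 : polar Q (vec p) (vec r) = 0
  · rw [h0] at hQc hpc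
    -- A vector orthogonal to `α` and to `p + r` that is not orthogonal to `p`.
    obtain ⟨b, hb, hbp⟩ := exists_polar_eq_one_of_contains hQ
      (hα.sup_span_singleton hQc hcorth) (map_vec p) (fun w hw => by
        obtain ⟨a, ha, d, hd, rfl⟩ := Submodule.mem_sup.1 hw
        obtain ⟨k, rfl⟩ := Submodule.mem_span_singleton.1 hd
        rw [polar_add_left, polar_smul_left, polar_comm Q a, hporth a ha,
          polar_comm Q _ (vec p), hpc, smul_zero, add_zero]) (fun hmem => by
        obtain ⟨a, ha, d, hd, h⟩ := Submodule.mem_sup.1 hmem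
        obtain ⟨k, rfl⟩ := Submodule.mem_span_singleton.1 hd
        rcases (by decide : ∀ k : ZMod 2, k = 0 ∨ k = 1) k with rfl | rfl
        · rw [zero_smul, add_zero] at h
          exact hpα (h ▸ ha)
        · rw [one_smul, add_left_comm, add_eq_left, add_eq_zero_iff_eq_neg,
            ZModModule.neg_eq_self] at h
          exact hrα (h ▸ ha))
    have hbc := hb _ (Submodule.mem_sup_right (Submodule.mem_span_singleton_self _))
    refine exists_mem_autGroup_of_isometry_apply hQ (map_siegel hQc (by rw [polar_comm, hbc]))
      (fun a ha => ?_) ((siegel_apply_of_polar_eq_one hpc hbp).trans ?_)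
    · have hab : polar Q a b = 0 := by rw [polar_comm, hb a (Submodule.mem_sup_left ha)]
      simpa [siegel_apply, hcorth a ha, hab] using ha
    · rw [← add_assoc, ZModModule.add_self, zero_add]
  · have h1 := eq_one_of_ne_zero h0
    refine exists_mem_autGroup_of_isometry_apply hQ (map_reflection (hQc.trans h1))
      (fun a ha => ?_) ?_
    · simpa [reflection_apply, hcorth a ha] using ha
    · rw [reflection_apply, hpc, h1, one_smul, ← add_assoc, ZModModule.add_self, zero_add]

lemma exists_apply_eq_of_mem_typeThree [Finite V] (hQ : IsNonsingular Q) (hα : Contains Q α)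
    {p r : Point Q} (hp : p ∈ typeThree Q α) (hr : r ∈ typeThree Q α) :
    ∃ φ ∈ (pointGraph Q).autGroup ⊓
      MulAction.stabilizer (Equiv.Perm (Point Q)) (typeOne Q α), φ p = r := by
  obtain ⟨a, ha, hpa, hra⟩ :=
    exists_polar_eq_one_and ((mem_typeThree hα).1 hp) ((mem_typeThree hα).1 hr)
  refine exists_mem_autGroup_of_isometry_apply hQ (map_siegel (b := vec p + vec r) (hα a ha) ?_)
    (fun b hb => siegel_mem ha (hα.polar_eq_zero hb ha) hb)
    (siegel_add_apply (map_vec p) (map_vec r) hpa)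
  rw [polar_comm, polar_add_left, hpa, hra]
  rfl

theorem orbit_switchedGraph [Finite V] (hQ : IsNonsingular Q) (hα : Contains Q α)
    (hdim : 2 ≤ Module.finrank (ZMod 2) α) (hne : (typeTwo Q α).Nonempty) {p : Point Q}
    {S : Set (Point Q)} (hS : S ∈ ({typeOne Q α, typeTwo Q α, typeThree Q α} : Set _))
    (hp : p ∈ S) : MulAction.orbit (switchedGraph Q α).autGroup p = S := by
  rw [autGroup_switchedGraph hQ hα hdim hne]
  ext r
  rw [MulAction.mem_orbit_iff]
  constructor
  · rintro ⟨⟨φ, hφ, h1⟩, rfl⟩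
    have h1 := MulAction.mem_stabilizer_set.1 h1
    have h23 := apply_mem_type_iff hα h1 (fun r _ p => hφ r p) p
    rcases hS with rfl | rfl | rfl
    · exact (h1 p).2 hp
    · exact h23.1.2 hp
    · exact h23.2.2 hp
  · intro hr
    suffices ∃ φ ∈ (pointGraph Q).autGroup ⊓
        MulAction.stabilizer (Equiv.Perm (Point Q)) (typeOne Q α), φ p = r by
      obtain ⟨φ, hφ, h⟩ := this
      exact ⟨⟨φ, hφ⟩, h⟩
    rcases hS with rfl | rfl | rfl
    · exact exists_apply_eq_of_mem_typeOne hQ hα hp hr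
    · exact exists_apply_eq_of_mem_typeTwo hQ hα hp hr
    · exact exists_apply_eq_of_mem_typeThree hQ hα hp hr

theorem range_orbit_switchedGraph [Finite V] (hQ : IsNonsingular Q) (hα : Contains Q α)
    (hdim : 2 ≤ Module.finrank (ZMod 2) α) (hne : (typeTwo Q α).Nonempty) :
    Set.range (fun p : Point Q => MulAction.orbit (switchedGraph Q α).autGroup p) =
        {typeOne Q α, typeTwo Q α, typeThree Q α} ∧
      (Set.range (fun p : Point Q => MulAction.orbit (switchedGraph Q α).autGroup p)).ncard =
        3 := by
  have hα0 : α ≠ ⊥ := by rintro rfl; simp at hdim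
  obtain ⟨x, hx⟩ := hne
  have horb := fun (p : Point Q) S hS hp => orbit_switchedGraph hQ hα hdim ⟨x, hx⟩ (p := p)
    (S := S) hS hp
  obtain ⟨y, hy, -⟩ := exists_typeThree_polar_eq_one hQ hα hα0 hx
  obtain ⟨a, ha, ha0⟩ := Submodule.exists_mem_ne_zero_of_ne_bot hα0
  obtain ⟨z, rfl⟩ := exists_vec_eq ha0 (hα a ha)
  have hz : z ∈ typeOne Q α := mem_typeOne.2 ha
  have hrange : Set.range (fun p : Point Q => MulAction.orbit (switchedGraph Q α).autGroup p) =
      {typeOne Q α, typeTwo Q α, typeThree Q α} := by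
    ext S
    constructor
    · rintro ⟨p, rfl⟩
      obtain ⟨S, hS, hpS⟩ :
          ∃ S ∈ ({typeOne Q α, typeTwo Q α, typeThree Q α} : Set _), p ∈ S := by
        by_cases h1 : p ∈ typeOne Q α
        · exact ⟨_, by simp, h1⟩
        by_cases h2 : p ∈ typeTwo Q α
        · exact ⟨_, by simp, h2⟩
        · exact ⟨typeThree Q α, by simp, h1, h2⟩
      change MulAction.orbit _ p ∈ _
      rwa [horb p S hS hpS]
    · intro hS
      have : ∃ p, p ∈ S := by
        rcases hS with rfl | rfl | rfl
        exacts [⟨z, hz⟩, ⟨x, hx⟩, ⟨y, hy⟩]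
      obtain ⟨p, hp⟩ := this
      exact ⟨p, horb p S hS hp⟩
  refine ⟨hrange, hrange ▸ Set.ncard_eq_three.2 ⟨_, _, _, ?_, ?_, ?_, rfl⟩⟩
  · exact fun h => hx.1 (h ▸ hx)
  · exact fun h => hy.1 (h ▸ hy)
  · exact fun h => hy.2 (h ▸ hy)

end Quadric

/-- Let `Q` define a non-singular quadric in `PG(n, 2)` of projective index `g`, with point-graph
`Γ`, let `α` be an `s`-space contained in it, `0 < s < g`, and let `Γ_s` be the graph obtained from
`Γ` and `α`. Then `Aut(Γ_s)` is the setwise stabiliser of the points of `α` in `Aut(Γ)`, and its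
orbits on the vertices are exactly the three point types. -/
theorem theorem7p1 (n g s : ℕ) (Q : QuadraticForm (ZMod 2) (Fin (n + 1) → ZMod 2))
    (hQ : Quadric.IsNonsingular Q) (hg : Quadric.IsProjectiveIndex Q g)
    (hs : 0 < s) (hsg : s < g)
    (α : Submodule (ZMod 2) (Fin (n + 1) → ZMod 2))
    (hα : Module.finrank (ZMod 2) α = s + 1) (hαQ : Quadric.Contains Q α) :
    (Quadric.switchedGraph Q α).autGroup =
        (Quadric.pointGraph Q).autGroup ⊓
          MulAction.stabilizer (Equiv.Perm (Quadric.Point Q)) (Quadric.typeOne Q α) ∧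
      Set.range (fun p : Quadric.Point Q =>
          MulAction.orbit (Quadric.switchedGraph Q α).autGroup p) =
        {Quadric.typeOne Q α, Quadric.typeTwo Q α, Quadric.typeThree Q α} ∧
      (Set.range (fun p : Quadric.Point Q =>
          MulAction.orbit (Quadric.switchedGraph Q α).autGroup p)).ncard = 3 := by
  have hdim : 2 ≤ Module.finrank (ZMod 2) α := by omega
  obtain ⟨U, hU, hUQ⟩ := hg.1
  obtain ⟨x, hxα, hx, horth⟩ :=
    Quadric.exists_singular_orthogonal_notMem (W := α) hUQ (by omega)
  obtain ⟨p, rfl⟩ := Quadric.exists_vec_eq (by rintro rfl; exact hxα α.zero_mem) hx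
  have hne : (Quadric.typeTwo Q α).Nonempty := ⟨p, (Quadric.mem_typeTwo hαQ).2
    ⟨hxα, fun a ha => by rw [QuadraticMap.polar_comm]; exact horth a ha⟩⟩
  exact ⟨Quadric.autGroup_switchedGraph hQ hαQ hdim hne,
    Quadric.range_orbit_switchedGraph hQ hαQ hdim hne⟩
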